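/- A partially-commutative grammar over a finite alphabet $\Sigma$ consists of a finite set $V$ of non-terminals with an initial symbol $S\in V$, a finite set of productions of the form $X \xrightarrow{a} \alpha$ with $X\in V$, $a\in\Sigma$, $\alpha\in V^*$, and a symmetric irreflexive independence relation $I\subseteq V\times V$. Its dependence relation is $D=(V\times V)\setminus I$. Configurations are words in $V^*$, and there are two kinds of steps: production steps $X\beta \xrightarrow{a} \alpha\beta$ for a production $X\xrightarrow{a}\alpha$ and $\beta\in V^*$, and swap steps $\alpha XY\beta \to \alpha YX\beta$ for $(X,Y)\in I$ and $\alpha,\beta\in V^*$. The language generated by the grammar is the set of all words $w\in\Sigma^*$ such that some finite sequence of steps leads from the configuration $S$ to the empty configuration and the letters of its production steps, in order, form $w$. The class trPCCFL consists of the languages generated by partially-commutative grammars whose dependence relation $D$ is transitive. The class trPCCFL is not closed under concatenation: it is not true that for every finite alphabet $\Sigma$ and all languages $L,K\subseteq\Sigma^*$ in trPCCFL the language $LK$ is in trPCCFL. Specifically, let $$L_1=\{w\in\{a,b,c,d\}^* : \#_a(w)=\#_b(w)=\#_c(w)\ge 1,\ \#_d(w)=0\},\qquad L_2=\{d\},$$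 where $\#_x(w)$ is the number of occurrences of the letter $x$ in $w$. Then $L_1$ and $L_2$ belong to trPCCFL, but $L_1L_2$ does not. -/

import Mathlib

/-- A Greibach grammar with finitely many non-terminals and finitely many productions
`X →[a] α` (stored as triples `(X, a, α)`), equipped with a symmetric and irreflexive
independence relation on its non-terminals. -/
structure PCGrammar (T : Type) where
  /-- the non-terminal symbols -/
  NT : Type
  finite_NT : Finite NT
  /-- the initial non-terminal -/
  initial : NT
  /-- the productions -/
  prods : Set (NT × T × List NT)
  finite_prods : prods.Finite
  /-- the independence relation -/
  Indep : NT → NT → Prop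
  indep_symm : ∀ X Y, Indep X Y → Indep Y X
  indep_irrefl : ∀ X, ¬ Indep X X

namespace PCGrammar

variable {T : Type}

/-- The dependence relation: the complement of independence. -/
def Dep (G : PCGrammar T) (X Y : G.NT) : Prop := ¬ G.Indep X Y

/-- A production step `X β →[a] α β`, for a production `X →[a] α`. Only the first symbol of a
configuration is rewritten. -/
inductive ProdStep (G : PCGrammar T) : List G.NT → T → List G.NT → Prop
  | mk (X : G.NT) (a : T) (α β : List G.NT) (h : (X, a, α) ∈ G.prods) :
      ProdStep G (X :: β) a (α ++ β)

/-- A swap step `α X Y β → α Y X β`, for independent `X` and `Y`. -/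
inductive SwapStep (G : PCGrammar T) : List G.NT → List G.NT → Prop
  | mk (α : List G.NT) (X Y : G.NT) (β : List G.NT) (h : G.Indep X Y) :
      SwapStep G (α ++ X :: Y :: β) (α ++ Y :: X :: β)

/-- `G.Derives α w β`: a finite sequence of production and swap steps leads from the
configuration `α` to the configuration `β`, and the letters of its production steps, in order,
form the word `w`. -/
inductive Derives (G : PCGrammar T) : List G.NT → List T → List G.NT → Prop
  | nil (α : List G.NT) : Derives G α [] α
  | prod {α β γ : List G.NT} {a : T} {w : List T} :
      G.ProdStep α a β → Derives G β w γ → Derives G α (a :: w) γ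
  | swap {α β γ : List G.NT} {w : List T} :
      G.SwapStep α β → Derives G β w γ → Derives G α w γ

/-- The language generated by the grammar: all words `w` for which some derivation from the
initial non-terminal to the empty configuration defines `w`. -/
def language (G : PCGrammar T) : Language T := {w | G.Derives [G.initial] w []}

/-- Transitivity of the dependence relation. -/
def TransitiveDep (G : PCGrammar T) : Prop :=
  ∀ X Y Z : G.NT, G.Dep X Y → G.Dep Y Z → G.Dep X Z

end PCGrammar

/-- The class trPCCFL: languages generated by a partially-commutative Greibach grammar whose
dependence relation is transitive. -/
def IsTrPCCFL {T : Type} (L : Language T) : Prop :=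
  ∃ G : PCGrammar T, G.TransitiveDep ∧ G.language = L

/-- The alphabet `{a, b, c, d}`. -/
inductive Letter
  | a | b | c | d
  deriving DecidableEq

instance : Fintype Letter :=
  ⟨{Letter.a, Letter.b, Letter.c, Letter.d}, by intro x; cases x <;> simp⟩

/-- The words over `{a, b, c, d}` with equally many, and at least one, `a`, `b` and `c`,
and without `d`. -/
def langABC : Language Letter :=
  {w | w.count Letter.a = w.count Letter.b ∧ w.count Letter.b = w.count Letter.c ∧
    1 ≤ w.count Letter.a ∧ w.count Letter.d = 0}

/-!
Suppose that a grammar with transitive dependence generates a language whose words have the letter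
`d` at the end and nowhere else. In a configuration that occurs in an accepting derivation, every
symbol other than the last one depends on some later symbol: otherwise it could be swapped to the
end, so that some words end with a factor that it generates, while others have this factor strictly
inside. By transitivity all symbols of the configuration are then mutually dependent, so no swap is
possible and the language is generated by leftmost derivations alone. As for context-free languages,
a factor of bounded length of a long word can then be replaced by a strictly shorter one. In
`aⁿ bⁿ cⁿ d` such a factor misses `a` or `c`, so that a replacement preserving the equality of the
three counts cannot shorten the word.
-/

namespace PCGrammar

variable {T : Type} {G : PCGrammar T}

/-- The words by which a configuration can be rewritten to the empty one. -/
def languageFrom (G : PCGrammar T) (γ : List G.NT) : Language T := {w | G.Derives γ w []}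

lemma nil_mem_languageFrom_nil : [] ∈ G.languageFrom [] := Derives.nil []

lemma cons_mem_languageFrom {X : G.NT} {a : T} {α β : List G.NT} {w : List T}
    (hp : (X, a, α) ∈ G.prods) (hw : w ∈ G.languageFrom (α ++ β)) :
    a :: w ∈ G.languageFrom (X :: β) :=
  .prod (.mk X a α β hp) hw

lemma languageFrom_swap {X Y : G.NT} (hI : G.Indep X Y) (α β : List G.NT) :
    G.languageFrom (α ++ X :: Y :: β) = G.languageFrom (α ++ Y :: X :: β) :=
  Set.Subset.antisymm (fun _ => .swap (.mk α Y X β (G.indep_symm X Y hI)))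
    fun _ => .swap (.mk α X Y β hI)

@[elab_as_elim]
lemma languageFrom_induction {motive : (γ : List G.NT) → (w : List T) → w ∈ G.languageFrom γ → Prop}
    (nil : motive [] [] nil_mem_languageFrom_nil)
    (prod : ∀ X a α β w (hp : (X, a, α) ∈ G.prods) (hw : w ∈ G.languageFrom (α ++ β)),
      motive (α ++ β) w hw → motive (X :: β) (a :: w) (cons_mem_languageFrom hp hw))
    (swap : ∀ α X Y β w (hI : G.Indep X Y) (hw : w ∈ G.languageFrom (α ++ Y :: X :: β)),
      motive (α ++ Y :: X :: β) w hw →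
      motive (α ++ X :: Y :: β) w ((languageFrom_swap hI α β).symm ▸ hw))
    {γ : List G.NT} {w : List T} (hw : w ∈ G.languageFrom γ) : motive γ w hw := by
  suffices ∀ δ, G.Derives γ w δ → δ = [] → ∀ hw : w ∈ G.languageFrom γ, motive γ w hw from
    this [] hw rfl hw
  clear hw
  intro δ h hδ
  induction h with
  | nil => subst hδ; exact fun _ => nil
  | prod hstep h ih =>
    subst hδ
    obtain ⟨X, _, α, β, hp⟩ := hstep
    exact fun _ => prod X _ α β _ hp h (ih rfl h)
  | swap hstep h ih =>
    subst hδ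
    obtain ⟨α, X, Y, β, hI⟩ := hstep
    exact fun _ => swap α X Y β _ hI h (ih rfl h)

lemma languageFrom_move_right {W : G.NT} {β : List G.NT} (hW : ∀ V ∈ β, G.Indep W V)
    (α γ : List G.NT) :
    G.languageFrom (α ++ W :: (β ++ γ)) = G.languageFrom (α ++ β ++ W :: γ) := by
  induction β generalizing α with
  | nil => simp
  | cons V β ih =>
    rw [List.forall_mem_cons] at hW
    simpa using (languageFrom_swap hW.1 α (β ++ γ)).trans (by simpa using ih hW.2 (α ++ [V]))

lemma languageFrom_perm (hI : ∀ X Y, X ≠ Y → G.Indep X Y) {γ δ : List G.NT} (h : γ.Perm δ) :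
    G.languageFrom γ = G.languageFrom δ := by
  suffices ∀ α, G.languageFrom (α ++ γ) = G.languageFrom (α ++ δ) from this []
  induction h with
  | nil => exact fun _ => rfl
  | cons X _ ih => exact fun α => by simpa using ih (α ++ [X])
  | swap X Y β =>
    intro α
    rcases eq_or_ne Y X with rfl | hne
    · rfl
    · exact languageFrom_swap (hI Y X hne) α β
  | trans _ _ ih₁ ih₂ => exact fun α => (ih₁ α).trans (ih₂ α)

lemma append_mem_languageFrom {α β : List G.NT} {u v : List T} (hu : u ∈ G.languageFrom α)
    (hv : v ∈ G.languageFrom β) : u ++ v ∈ G.languageFrom (α ++ β) := by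
  induction hu using languageFrom_induction with
  | nil => exact hv
  | prod X a α γ u hp _ ih => exact cons_mem_languageFrom hp (by simpa using ih)
  | swap α X Y γ u hI _ ih =>
    rw [List.append_assoc] at ih ⊢
    exact (languageFrom_swap hI α (γ ++ β)).symm ▸ ih

lemma ne_nil_of_mem_languageFrom {γ : List G.NT} {w : List T} (hw : w ∈ G.languageFrom γ)
    (hγ : γ ≠ []) : w ≠ [] := by
  induction hw using languageFrom_induction with
  | nil => exact absurd rfl hγ
  | prod => exact List.cons_ne_nil _ _
  | swap α X Y β _ _ _ ih => exact ih (by simp)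

/-- A configuration is productive if it can be rewritten to the empty one. -/
def Productive (G : PCGrammar T) (γ : List G.NT) : Prop := ∃ w, w ∈ G.languageFrom γ

lemma productive_of_forall_mem {γ : List G.NT} (h : ∀ X ∈ γ, G.Productive [X]) :
    G.Productive γ := by
  induction γ with
  | nil => exact ⟨[], nil_mem_languageFrom_nil⟩
  | cons X γ ih =>
    rw [List.forall_mem_cons] at h
    obtain ⟨u, hu⟩ := h.1
    obtain ⟨v, hv⟩ := ih h.2
    exact ⟨u ++ v, append_mem_languageFrom hu hv⟩

lemma Productive.of_mem {γ : List G.NT} (h : G.Productive γ) : ∀ X ∈ γ, G.Productive [X] := by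
  obtain ⟨w, hw⟩ := h
  induction hw using languageFrom_induction with
  | nil => simp
  | prod X a α β _ hp _ ih =>
    rw [List.forall_mem_append] at ih
    obtain ⟨v, hv⟩ := productive_of_forall_mem ih.1
    exact List.forall_mem_cons.2
      ⟨⟨a :: v, cons_mem_languageFrom hp (by simpa using hv)⟩, ih.2⟩
  | swap α X Y β _ _ _ ih =>
    exact fun Z hZ => ih Z (((List.Perm.swap Y X β).append_left α).mem_iff.1 hZ)

lemma productive_append {α β : List G.NT} :
    G.Productive (α ++ β) ↔ G.Productive α ∧ G.Productive β := by
  refine ⟨fun h => ?_, fun ⟨⟨u, hu⟩, v, hv⟩ => ⟨u ++ v, append_mem_languageFrom hu hv⟩⟩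
  have := List.forall_mem_append.1 h.of_mem
  exact ⟨productive_of_forall_mem this.1, productive_of_forall_mem this.2⟩

lemma dep_self (X : G.NT) : G.Dep X X := G.indep_irrefl X

instance : Std.Symm G.Dep := ⟨fun X Y => mt (G.indep_symm Y X)⟩

end PCGrammar

/-- The letter `d` is the last letter of every nonempty word of `L` and does not occur elsewhere in
it. This is expressed through factorizations, and the empty word is allowed, so that the notion
passes to left quotients. -/
def EndMarked {T : Type} (d : T) (L : Language T) : Prop :=
  ∀ x y : List T, x ++ y ∈ L → y ≠ [] → d ∈ y ∧ d ∉ x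

lemma EndMarked.of_forall_append_mem {T : Type} {d : T} {L K : Language T} (h : EndMarked d L)
    (p : List T) (hK : ∀ w ∈ K, p ++ w ∈ L) : EndMarked d K := by
  intro x y hxy hy
  have := h (p ++ x) y (by simpa using hK _ hxy) hy
  exact ⟨this.1, mt (List.mem_append_right p) this.2⟩

lemma endMarked_mul_singleton {T : Type} {d : T} {K : Language T} (hK : ∀ w ∈ K, d ∉ w) :
    EndMarked d (K * ({[d]} : Language T)) := by
  rintro x y ⟨u, hu, _, rfl, hxy : u ++ [d] = x ++ y⟩ hy
  obtain ⟨z, e, rfl⟩ := (List.eq_nil_or_concat' y).resolve_left hy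
  obtain ⟨rfl, hde⟩ := List.append_inj' (hxy.trans (List.append_assoc x z [e]).symm) rfl
  exact ⟨List.mem_append_right z (hde ▸ List.mem_singleton_self d),
    mt (List.mem_append_left z) (hK _ hu)⟩

namespace PCGrammar

variable {T : Type} {G : PCGrammar T} {d : T}

lemma exists_dep_of_endMarked {α β : List G.NT} {W : G.NT}
    (hd : EndMarked d (G.languageFrom (α ++ W :: β))) (hprod : G.Productive (α ++ W :: β))
    (hβ : β ≠ []) : ∃ V ∈ β, G.Dep W V := by
  by_contra! hindep
  simp only [Dep, not_not] at hindep
  obtain ⟨⟨u, hu⟩, ⟨w, hw⟩, v, hv⟩ : G.Productive α ∧ G.Productive [W] ∧ G.Productive β := by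
    rwa [← List.singleton_append, productive_append, productive_append] at hprod
  have w_inside : (u ++ w) ++ v ∈ G.languageFrom (α ++ W :: β) := by
    simpa using append_mem_languageFrom (append_mem_languageFrom hu hw) hv
  have w_last : (u ++ v) ++ w ∈ G.languageFrom (α ++ W :: β) := by
    have hmove := languageFrom_move_right hindep α []
    rw [List.append_nil] at hmove
    exact hmove ▸ append_mem_languageFrom (append_mem_languageFrom hu hv) hw
  have d_notMem := (hd _ _ w_inside (ne_nil_of_mem_languageFrom hv hβ)).2
  have d_mem := (hd _ _ w_last (ne_nil_of_mem_languageFrom hw (by simp))).1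
  exact d_notMem (List.mem_append_right u d_mem)

lemma pairwise_dep_of_endMarked (hG : G.TransitiveDep) {α β : List G.NT}
    (hd : EndMarked d (G.languageFrom (α ++ β))) (hprod : G.Productive (α ++ β)) :
    β.Pairwise G.Dep := by
  induction β generalizing α with
  | nil => exact .nil
  | cons W β ih =>
    have hβ : β.Pairwise G.Dep := ih (α := α ++ [W]) (by simpa using hd) (by simpa using hprod)
    refine .cons (fun U hU => ?_) hβ
    obtain ⟨V, hV, hWV⟩ := exists_dep_of_endMarked hd hprod (List.ne_nil_of_mem hU)
    have hVU : G.Dep V U := hβ.forall_of_forall (fun X _ => dep_self X) hV hU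
    exact hG W V U hWV hVU

/-- Derivations to the empty configuration without swap steps, that is, leftmost derivations of the
underlying context-free grammar. -/
inductive LeftmostDerives (G : PCGrammar T) : List G.NT → List T → Prop
  | nil : LeftmostDerives G [] []
  | cons {X : G.NT} {a : T} {α β : List G.NT} {w : List T} :
      (X, a, α) ∈ G.prods → LeftmostDerives G (α ++ β) w → LeftmostDerives G (X :: β) (a :: w)

lemma LeftmostDerives.mem_languageFrom {γ : List G.NT} {w : List T}
    (h : G.LeftmostDerives γ w) : w ∈ G.languageFrom γ := by
  induction h with
  | nil => exact nil_mem_languageFrom_nil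
  | cons hp _ ih => exact cons_mem_languageFrom hp ih

lemma leftmostDerives_of_endMarked (hG : G.TransitiveDep) {γ : List G.NT} {w : List T}
    (hw : w ∈ G.languageFrom γ) (hd : EndMarked d (G.languageFrom γ)) :
    G.LeftmostDerives γ w := by
  induction hw using languageFrom_induction with
  | nil => exact .nil
  | prod X a α β w hp _ ih =>
    exact .cons hp (ih (hd.of_forall_append_mem [a] fun _ => cons_mem_languageFrom hp))
  | swap α X Y β w hI hw _ =>
    rw [← languageFrom_swap hI] at hw
    have hdep := pairwise_dep_of_endMarked hG (α := α) hd ⟨w, hw⟩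
    exact absurd hI (List.rel_of_pairwise_cons hdep List.mem_cons_self)

lemma mem_language_iff_leftmostDerives (hG : G.TransitiveDep) (hd : EndMarked d G.language)
    {w : List T} : w ∈ G.language ↔ G.LeftmostDerives [G.initial] w :=
  ⟨fun hw => leftmostDerives_of_endMarked hG hw hd, LeftmostDerives.mem_languageFrom⟩

namespace LeftmostDerives

lemma append {α β : List G.NT} {u v : List T} (hu : G.LeftmostDerives α u)
    (hv : G.LeftmostDerives β v) : G.LeftmostDerives (α ++ β) (u ++ v) := by
  induction hu with
  | nil => exact hv
  | cons hp _ ih => exact .cons hp (by simpa using ih)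

lemma exists_of_append {α β : List G.NT} {w : List T} (h : G.LeftmostDerives (α ++ β) w) :
    ∃ u v, w = u ++ v ∧ G.LeftmostDerives α u ∧ G.LeftmostDerives β v := by
  generalize hγ : α ++ β = γ at h
  induction h generalizing α with
  | nil =>
    obtain ⟨rfl, rfl⟩ := List.append_eq_nil_iff.1 hγ
    exact ⟨[], [], rfl, .nil, .nil⟩
  | @cons X a δ ζ w hp h ih =>
    rcases List.append_eq_cons_iff.1 hγ with ⟨rfl, rfl⟩ | ⟨α, rfl, rfl⟩
    · exact ⟨[], a :: w, rfl, .nil, .cons hp h⟩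
    · obtain ⟨u, v, rfl, hu, hv⟩ := ih (α := δ ++ α) (by simp)
      exact ⟨a :: u, v, rfl, .cons hp hu, hv⟩

lemma exists_symbol_long_factor {γ : List G.NT} {w : List T} {B : ℕ}
    (h : G.LeftmostDerives γ w) (hw : B * γ.length < w.length) :
    ∃ Y p u s, w = p ++ u ++ s ∧ B < u.length ∧ G.LeftmostDerives [Y] u ∧
      ∀ v, G.LeftmostDerives [Y] v → G.LeftmostDerives γ (p ++ v ++ s) := by
  induction γ generalizing w with
  | nil => cases h; simp at hw
  | cons X γ ih =>
    obtain ⟨u, v, rfl, hu, hv⟩ := exists_of_append (α := [X]) h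
    by_cases hB : B < u.length
    · exact ⟨X, [], u, v, rfl, hB, hu, fun v' hv' => hv'.append hv⟩
    · have hlong : B * γ.length < v.length := by
        simp only [List.length_cons, List.length_append, mul_add, mul_one] at hw
        omega
      obtain ⟨Y, p, u', s, rfl, hB', hY, hctx⟩ := ih hv hlong
      exact ⟨Y, u ++ p, u', s, by simp, hB', hY,
        fun v' hv' => by simpa using hu.append (hctx v' hv')⟩

lemma exists_symbol_medium_factor {m B : ℕ} (hm : ∀ X a α, (X, a, α) ∈ G.prods → α.length ≤ m)
    {X : G.NT} {w : List T} (h : G.LeftmostDerives [X] w) (hw : B < w.length) :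
    ∃ Y p u s, w = p ++ u ++ s ∧ B < u.length ∧ u.length ≤ B * m + 1 ∧ G.LeftmostDerives [Y] u ∧
      ∀ v, G.LeftmostDerives [Y] v → G.LeftmostDerives [X] (p ++ v ++ s) := by
  induction hn : w.length using Nat.strong_induction_on generalizing X w with
  | _ n ih =>
    subst hn
    by_cases hle : w.length ≤ B * m + 1
    · exact ⟨X, [], w, [], by simp, hw, hle, h, fun v hv => by simpa using hv⟩
    · obtain _ | @⟨_, a, α, _, w, hp, hα⟩ := h
      rw [List.append_nil] at hα
      rw [List.length_cons] at hle
      have hα_long : B * α.length < w.length := by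
        have := Nat.mul_le_mul_left B (hm _ _ _ hp)
        omega
      obtain ⟨Y, p, u, s, rfl, hBu, hY, hctx⟩ := hα.exists_symbol_long_factor hα_long
      have hu_shorter : u.length < (a :: (p ++ u ++ s)).length := by
        simp only [List.length_cons, List.length_append]
        omega
      obtain ⟨Z, p', u', s', rfl, hBu', hu'm, hZ, hctx'⟩ := ih u.length hu_shorter hY hBu rfl
      exact ⟨Z, a :: p ++ p', u', s' ++ s, by simp, hBu', hu'm, hZ,
        fun v hv => .cons hp (by simpa using hctx _ (hctx' v hv))⟩

end LeftmostDerives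

lemma exists_forall_short_leftmostDerives (G : PCGrammar T) :
    ∃ C, ∀ X u, G.LeftmostDerives [X] u → ∃ v, G.LeftmostDerives [X] v ∧ v.length ≤ C := by
  have := G.finite_NT
  let lengths (X : G.NT) : Set ℕ := {n | ∃ v, G.LeftmostDerives [X] v ∧ v.length = n}
  obtain ⟨C, hC⟩ := (Set.finite_range fun X => sInf (lengths X)).bddAbove
  refine ⟨C, fun X u hu => ?_⟩
  obtain ⟨v, hv, hlen⟩ : sInf (lengths X) ∈ lengths X := Nat.sInf_mem ⟨u.length, u, hu, rfl⟩
  exact ⟨v, hv, hlen.le.trans (hC ⟨X, rfl⟩)⟩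

lemma exists_shorter_factor_of_leftmostDerives (G : PCGrammar T) (X : G.NT) :
    ∃ N, ∀ w, G.LeftmostDerives [X] w → N ≤ w.length → ∃ p u v s, w = p ++ u ++ s ∧
      u.length ≤ N ∧ v.length < u.length ∧ G.LeftmostDerives [X] (p ++ v ++ s) := by
  obtain ⟨C, hC⟩ := G.exists_forall_short_leftmostDerives
  obtain ⟨m, hm⟩ := (G.finite_prods.image fun q => q.2.2.length).bddAbove
  refine ⟨C * m + 1 + C, fun w hw hN => ?_⟩
  obtain ⟨Y, p, u, s, rfl, hCu, hum, hY, hctx⟩ := hw.exists_symbol_medium_factor (B := C)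
    (fun _ _ _ hp => hm ⟨_, hp, rfl⟩) (by omega)
  obtain ⟨v, hv, hvC⟩ := hC Y u hY
  exact ⟨p, u, v, s, rfl, by omega, by omega, hctx v hv⟩

end PCGrammar

lemma IsTrPCCFL.exists_shorter_factor {T : Type} {d : T} {L : Language T} (hL : IsTrPCCFL L)
    (hd : EndMarked d L) : ∃ N, ∀ w ∈ L, N ≤ w.length → ∃ p u v s, w = p ++ u ++ s ∧
      u.length ≤ N ∧ v.length < u.length ∧ p ++ v ++ s ∈ L := by
  obtain ⟨G, hG, rfl⟩ := hL
  simpa only [G.mem_language_iff_leftmostDerives hG hd] using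
    G.exists_shorter_factor_of_leftmostDerives G.initial

lemma isInfix_append_or_of_length_le {A : Type*} {u x y z : List A} (h : u <:+: x ++ y ++ z)
    (hu : u.length ≤ y.length) : u <:+: x ++ y ∨ u <:+: y ++ z := by
  obtain ⟨p, s, h⟩ := h
  have hlen := congrArg List.length h
  simp only [List.length_append] at hlen
  rcases le_total p.length x.length with hp | hp
  · left
    have hpre : p ++ u <+: x ++ y :=
      List.prefix_of_prefix_length_le ⟨s, h⟩ ⟨z, rfl⟩ (by grind)
    exact (List.suffix_append p u).isInfix.trans hpre.isInfix
  · right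
    have hsuf : u ++ s <:+ y ++ z :=
      List.suffix_of_suffix_length_le ⟨p, by simpa using h⟩ ⟨x, by simp⟩ (by grind)
    exact (List.prefix_append u s).isInfix.trans hsuf.isInfix

lemma Letter.length_eq_sum_count (w : List Letter) :
    w.length = w.count .a + w.count .b + w.count .c + w.count .d := by
  induction w with
  | nil => rfl
  | cons x w ih => cases x <;> grind

lemma count_of_mem_langABC_mul_d {w : List Letter}
    (h : w ∈ langABC * ({[Letter.d]} : Language Letter)) :
    w.count .a = w.count .b ∧ w.count .b = w.count .c ∧ w.count .d = 1 := by
  obtain ⟨u, ⟨hab, hbc, -, hd⟩, _, rfl, rfl⟩ := h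
  simp [hab, hbc, hd]

lemma endMarked_langABC_mul_d :
    EndMarked Letter.d (langABC * ({[Letter.d]} : Language Letter)) :=
  endMarked_mul_singleton fun _ hw => List.count_eq_zero.1 hw.2.2.2

lemma not_isTrPCCFL_langABC_mul_d :
    ¬ IsTrPCCFL (langABC * ({[Letter.d]} : Language Letter)) := by
  intro hL
  obtain ⟨N, hN⟩ := hL.exists_shorter_factor endMarked_langABC_mul_d
  let n := N + 1
  let as := List.replicate n Letter.a
  let bs := List.replicate n Letter.b
  let cs := List.replicate n Letter.c
  have hmem : as ++ bs ++ (cs ++ [.d]) ∈ langABC * ({[Letter.d]} : Language Letter) :=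
    ⟨as ++ bs ++ cs, by simp [langABC, as, bs, cs, n, List.count_replicate], [.d], rfl, by simp⟩
  obtain ⟨p, u, v, s, hw, huN, hvu, hv⟩ := hN _ hmem (by grind)
  have hu : u.count .c = 0 ∨ u.count .a = 0 := by
    simp only [List.count_eq_zero]
    refine (isInfix_append_or_of_length_le ⟨p, s, hw.symm⟩ (by grind)).imp ?_ ?_ <;>
      exact fun h => mt (fun hx => h.mem hx) (by simp [as, bs, cs])
  have count_u := count_of_mem_langABC_mul_d (hw ▸ hmem)
  have count_v := count_of_mem_langABC_mul_d hv
  simp only [List.count_append] at count_u count_v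
  rw [Letter.length_eq_sum_count u, Letter.length_eq_sum_count v] at hvu
  omega

/-- The grammar with the single production `X →[x] ε`. -/
abbrev singletonGrammar {T : Type} (x : T) : PCGrammar T where
  NT := Unit
  finite_NT := inferInstance
  initial := ()
  prods := {((), x, [])}
  finite_prods := Set.finite_singleton _
  Indep _ _ := False
  indep_symm _ _ := id
  indep_irrefl _ := id

lemma singletonGrammar.eq_replicate_of_mem_languageFrom {T : Type} {x : T}
    {γ : List (singletonGrammar x).NT} {w : List T}
    (hw : w ∈ (singletonGrammar x).languageFrom γ) :
    w = List.replicate γ.length x := by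
  induction hw using PCGrammar.languageFrom_induction with
  | nil => rfl
  | prod X a α β w hp _ ih =>
    obtain ⟨rfl, rfl⟩ : a = x ∧ α = [] := by simpa using hp
    simp [ih, List.replicate_succ]
  | swap _ _ _ _ _ hI => exact hI.elim

lemma isTrPCCFL_singleton {T : Type} (x : T) : IsTrPCCFL ({[x]} : Language T) := by
  refine ⟨singletonGrammar x, fun _ _ _ _ _ => id, Set.Subset.antisymm ?_ ?_⟩
  · exact fun w hw => singletonGrammar.eq_replicate_of_mem_languageFrom hw
  · rintro _ rfl
    exact PCGrammar.cons_mem_languageFrom (Set.mem_singleton _) PCGrammar.nil_mem_languageFrom_nil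

section PermPowers

variable {T : Type}

/-- The words obtained by permuting the letters of a positive power of `u`. -/
def permPowers (u : List T) : Language T :=
  {w | ∃ m, 0 < m ∧ (w : Multiset T) = m • (u : Multiset T)}

variable [DecidableEq T] {u : List T}

lemma cons_erase_append_add_nsmul {x : T} (hx : x ∈ u) (v : List T) (m : ℕ) :
    x ::ₘ (((u.erase x ++ v : List T) : Multiset T) + m • (u : Multiset T)) =
      (v : Multiset T) + (m + 1) • (u : Multiset T) := by
  rw [succ_nsmul', ← Multiset.coe_add, ← Multiset.cons_add, ← Multiset.cons_add,
    ← Multiset.coe_erase, Multiset.cons_erase (Multiset.mem_coe.2 hx)]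
  abel

variable [Finite T]

/-- A commutative grammar for `permPowers u`. The non-terminal `some x` stands for a pending letter
`x`. The initial non-terminal `none` starts a new copy of `u` with any letter of `u`, makes the
other letters of the copy pending, and may stay for further copies. -/
abbrev permPowersGrammar (u : List T) : PCGrammar T where
  NT := Option T
  finite_NT := inferInstance
  initial := none
  prods := Set.range (fun x => (some x, x, [])) ∪
    ((fun x => (none, x, (u.erase x).map some)) '' {x | x ∈ u} ∪
      (fun x => (none, x, none :: (u.erase x).map some)) '' {x | x ∈ u})
  finite_prods := Set.toFinite _
  Indep X Y := X ≠ Y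
  indep_symm _ _ := Ne.symm
  indep_irrefl _ h := h rfl

namespace permPowersGrammar

lemma languageFrom_eq_of_perm {γ δ : List (Option T)} (h : γ.Perm δ) :
    (permPowersGrammar u).languageFrom γ = (permPowersGrammar u).languageFrom δ :=
  PCGrammar.languageFrom_perm (G := permPowersGrammar u) (fun _ _ => id) h

lemma exists_eq_add_nsmul_of_mem_languageFrom {γ : List (permPowersGrammar u).NT} {w : List T}
    (hw : w ∈ (permPowersGrammar u).languageFrom γ) :
    ∃ m, (none ∈ γ → 0 < m) ∧
      (w : Multiset T) = (γ.reduceOption : Multiset T) + m • (u : Multiset T) := by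
  induction hw using PCGrammar.languageFrom_induction with
  | nil => exact ⟨0, by simp⟩
  | prod X a α β w hp _ ih =>
    obtain ⟨m, hm, hw⟩ := ih
    rcases hp with ⟨x, hx⟩ | ⟨x, hxu, hx⟩ | ⟨x, hxu, hx⟩ <;> obtain ⟨rfl, rfl, rfl⟩ := hx
    · refine ⟨m, by simpa using hm, ?_⟩
      rw [← Multiset.cons_coe, hw]
      simp [← Multiset.cons_coe]
    all_goals
      refine ⟨m + 1, fun _ => m.succ_pos, ?_⟩
      have hred : ((u.erase a).map some).reduceOption = u.erase a := by simp [List.reduceOption]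
      rw [← Multiset.cons_coe, hw]
      simpa only [List.cons_append, List.reduceOption_cons_of_none, List.reduceOption_append,
        hred] using cons_erase_append_add_nsmul hxu β.reduceOption m
  | swap α X Y β w _ _ ih =>
    have hperm := (List.Perm.swap Y X β).append_left α
    rwa [hperm.mem_iff, List.reduceOption, Multiset.coe_eq_coe.2 (hperm.filterMap id)]

lemma mem_languageFrom_map_some (w : List T) :
    w ∈ (permPowersGrammar u).languageFrom (w.map some) := by
  induction w with
  | nil => exact PCGrammar.nil_mem_languageFrom_nil
  | cons x w ih => exact PCGrammar.cons_mem_languageFrom (Or.inl ⟨x, rfl⟩) ih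

lemma mem_languageFrom_none_cons {w v : List T} {m : ℕ} (hu : u ≠ [])
    (hw : (w : Multiset T) = (v : Multiset T) + (m + 1) • (u : Multiset T)) :
    w ∈ (permPowersGrammar u).languageFrom (none :: v.map some) := by
  induction w generalizing v m with
  | nil =>
    have hlen : 0 = v.length + (m + 1) * u.length := by simpa using congrArg Multiset.card hw
    have := Nat.mul_pos (Nat.add_one_pos m) (List.length_pos_iff.2 hu)
    omega
  | cons x w ih =>
    rw [← Multiset.cons_coe] at hw
    by_cases hxv : x ∈ v
    · have hv := Multiset.coe_eq_coe.2 (List.perm_cons_erase hxv)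
      rw [hv, ← Multiset.cons_coe, Multiset.cons_add, Multiset.cons_inj_right] at hw
      have hperm : (none :: v.map some).Perm (some x :: none :: (v.erase x).map some) :=
        (((List.perm_cons_erase hxv).map some).cons none).trans (.swap _ _ _)
      rw [languageFrom_eq_of_perm hperm]
      exact PCGrammar.cons_mem_languageFrom (Or.inl ⟨x, rfl⟩) (ih hw)
    · have hxu : x ∈ u := by
        have hx := hw ▸ Multiset.mem_cons_self x (w : Multiset T)
        simpa [hxv, Multiset.mem_nsmul] using hx
      rw [← cons_erase_append_add_nsmul hxu, Multiset.cons_inj_right] at hw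
      rcases m with _ | m
      · have hperm : w.Perm (u.erase x ++ v) := by simpa using hw
        refine PCGrammar.cons_mem_languageFrom (.inr (.inl ⟨x, hxu, rfl⟩)) ?_
        rw [← List.map_append, ← languageFrom_eq_of_perm (hperm.map some)]
        exact mem_languageFrom_map_some w
      · refine PCGrammar.cons_mem_languageFrom (.inr (.inr ⟨x, hxu, rfl⟩)) ?_
        simpa using ih hw

end permPowersGrammar

end PermPowers

lemma isTrPCCFL_permPowers {T : Type} [Finite T] {u : List T} (hu : u ≠ []) :
    IsTrPCCFL (permPowers u) := by
  classical
  refine ⟨permPowersGrammar u, fun X Y Z hXY hYZ => ?_, Set.Subset.antisymm ?_ ?_⟩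
  · rw [not_not.1 hXY]
    exact hYZ
  · intro w hw
    obtain ⟨m, hm, hw⟩ := permPowersGrammar.exists_eq_add_nsmul_of_mem_languageFrom (γ := [none]) hw
    exact ⟨m, hm List.mem_cons_self, by simpa using hw⟩
  · rintro w ⟨_ | m, hm, hw⟩
    · exact absurd hm (lt_irrefl 0)
    · exact permPowersGrammar.mem_languageFrom_none_cons (v := []) hu (by simpa using hw)

lemma langABC_eq_permPowers : langABC = permPowers [Letter.a, .b, .c] := by
  ext w
  constructor
  · rintro ⟨hab, hbc, ha, hd⟩
    refine ⟨w.count Letter.a, ha, Multiset.ext.2 fun x => ?_⟩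
    cases x <;> simp [*]
  · rintro ⟨m, hm, hw⟩
    have hcount x := congrArg (Multiset.count x) hw
    simp only [Multiset.coe_count, Multiset.count_nsmul] at hcount
    refine ⟨?_, ?_, ?_, ?_⟩ <;> simp [hcount, Nat.one_le_iff_ne_zero, hm.ne']

lemma isTrPCCFL_langABC : IsTrPCCFL langABC :=
  langABC_eq_permPowers ▸ isTrPCCFL_permPowers (List.cons_ne_nil _ _)

theorem mainTheorem10 :
    (¬ ∀ (T : Type) [Finite T] (L K : Language T),
      IsTrPCCFL L → IsTrPCCFL K → IsTrPCCFL (L * K)) ∧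
    IsTrPCCFL langABC ∧
    IsTrPCCFL ({[Letter.d]} : Language Letter) ∧
    ¬ IsTrPCCFL (langABC * ({[Letter.d]} : Language Letter)) :=
  ⟨fun hclosed => not_isTrPCCFL_langABC_mul_d
      (hclosed Letter _ _ isTrPCCFL_langABC (isTrPCCFL_singleton Letter.d)),
    isTrPCCFL_langABC, isTrPCCFL_singleton Letter.d, not_isTrPCCFL_langABC_mul_d⟩
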